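/- An exact category is a pair $(\mathcal{E},\mathcal{S})$ where $\mathcal{E}$ is an additive category and $\mathcal{S}$ is an isomorphism-closed class of kernel-cokernel pairs $X \xrightarrow{i} Y \xrightarrow{p} Z$ in $\mathcal{E}$ (so $i$ is a kernel of $p$ and $p$ is a cokernel of $i$), called admissible short exact sequences, such that the class of admissible monomorphisms (the maps $i$ occurring in $\mathcal{S}$) contains all identities, is closed under composition, and has pushouts along arbitrary morphisms, these being again admissible monomorphisms, and such that, dually, the class of admissible epimorphisms (the maps $p$ occurring in $\mathcal{S}$) contains all identities, is closed under composition, and has pullbacks along arbitrary morphisms, these being again admissible epimorphisms. **Proposition.** Let $(\mathcal{E},\mathcal{S})$ be an exact category and let $k \ge 0$. Let $\mathrm{Mor}_k(\mathcal{E})$ be the category of diagrams $X_1 \to X_2 \to \cdots \to X_{k+1}$ of $k$ composable morphisms in $\mathcal{E}$, and let $\mathrm{MMor}_k(\mathcal{E})$ be its full subcategory of those diagrams in which each of the $k$ morphisms is an admissible monomorphism in $\mathcal{E}$. Let $\mathrm{MMor}_k(\mathcal{S})$ be the class of sequences $X_\bullet \to Y_\bullet \to Z_\bullet$ in $\mathrm{MMor}_k(\mathcal{E})$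 such that $X_i \to Y_i \to Z_i$ belongs to $\mathcal{S}$ for every $1 \le i \le k+1$. Then $(\mathrm{MMor}_k(\mathcal{E}), \mathrm{MMor}_k(\mathcal{S}))$ is an exact category. -/

import Mathlib

open CategoryTheory CategoryTheory.Limits

universe v u

namespace ExactCat

variable {C : Type u} [Category.{v} C] [Preadditive C]

/-- A kernel-cokernel pair `X ⟶ Y ⟶ Z`: the first map is a kernel of the second and the
second map is a cokernel of the first. -/
def IsKernelCokernelPair (T : ShortComplex C) : Prop :=
  Nonempty (IsLimit (KernelFork.ofι T.f T.zero)) ∧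
    Nonempty (IsColimit (CokernelCofork.ofπ T.g T.zero))

/-- The admissible monomorphisms of a class `S` of sequences: the first maps of members of `S`. -/
def admissibleMono (S : ObjectProperty (ShortComplex C)) : MorphismProperty C :=
  fun _ Y i => ∃ (Z : C) (p : Y ⟶ Z) (w : i ≫ p = 0), S (ShortComplex.mk i p w)

/-- The admissible epimorphisms of a class `S` of sequences: the second maps of members of `S`. -/
def admissibleEpi (S : ObjectProperty (ShortComplex C)) : MorphismProperty C :=
  fun Y _ p => ∃ (X : C) (i : X ⟶ Y) (w : i ≫ p = 0), S (ShortComplex.mk i p w)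

/-- `(C, S)` is an exact category in the sense of Quillen: `C` is additive (it is preadditive and
has all finite biproducts, the empty one being a zero object), and `S` is an isomorphism-closed
class of kernel-cokernel pairs whose admissible monomorphisms (admissible epimorphisms) contain
the identities, are closed under composition, and have pushouts (pullbacks) along arbitrary
morphisms, which are again admissible monomorphisms (admissible epimorphisms). -/
structure IsExactCategory (S : ObjectProperty (ShortComplex C)) : Prop where
  hasFiniteBiproducts : HasFiniteBiproducts C
  isKernelCokernelPair : ∀ T : ShortComplex C, S T → IsKernelCokernelPair T
  of_iso : ∀ T T' : ShortComplex C, Nonempty (T ≅ T') → S T → S T'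
  mono_id : ∀ X : C, admissibleMono S (𝟙 X)
  epi_id : ∀ X : C, admissibleEpi S (𝟙 X)
  mono_comp : ∀ {X Y Z : C} (f : X ⟶ Y) (g : Y ⟶ Z),
    admissibleMono S f → admissibleMono S g → admissibleMono S (f ≫ g)
  epi_comp : ∀ {X Y Z : C} (f : X ⟶ Y) (g : Y ⟶ Z),
    admissibleEpi S f → admissibleEpi S g → admissibleEpi S (f ≫ g)
  mono_pushout : ∀ {X Y X' : C} (i : X ⟶ Y) (f : X ⟶ X'), admissibleMono S i →
    ∃ (Y' : C) (f' : Y ⟶ Y') (i' : X' ⟶ Y'), IsPushout i f f' i' ∧ admissibleMono S i'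
  epi_pullback : ∀ {Y Z Z' : C} (p : Y ⟶ Z) (f : Z' ⟶ Z), admissibleEpi S p →
    ∃ (Y' : C) (f' : Y' ⟶ Y) (p' : Y' ⟶ Z'), IsPullback f' p' p f ∧ admissibleEpi S p'

/-- The diagrams `X₀ ⟶ X₁ ⟶ ⋯ ⟶ X_k` of `k` composable morphisms, each of which is an admissible
monomorphism. -/
def isMonoChain (S : ObjectProperty (ShortComplex C)) (k : ℕ) :
    ObjectProperty (ComposableArrows C k) :=
  fun X => ∀ i : Fin k, admissibleMono S (X.map (homOfLE (Fin.castSucc_le_succ i)))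

/-- The monomorphism category: the full subcategory of the category `Fin (k + 1) ⥤ C` of diagrams
of `k` composable morphisms whose objects are the chains of `k` admissible monomorphisms. -/
abbrev MMor (S : ObjectProperty (ShortComplex C)) (k : ℕ) := (isMonoChain S k).FullSubcategory

/-- The sequences of diagrams of `k` composable morphisms that are admissible at each of the
`k + 1` places. -/
def morSeq (S : ObjectProperty (ShortComplex C)) (k : ℕ) :
    ObjectProperty (ShortComplex (ComposableArrows C k)) :=
  fun T => ∀ i : Fin (k + 1), S (T.map ((evaluation (Fin (k + 1)) C).obj i))

/-- The sequences in the monomorphism category that are admissible as sequences of diagrams,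
that is, admissible at each place. -/
def mmorSeq (S : ObjectProperty (ShortComplex C)) (k : ℕ) :
    ObjectProperty (ShortComplex (MMor S k)) :=
  fun T => morSeq S k (T.map (isMonoChain S k).ι)

end ExactCat

/-!
The sequences that are admissible at each place make the category of all diagrams of `k`
composable morphisms an exact category, as for any category of functors `J ⥤ C` with values in an
exact category `C` (`ExactCat.IsExactCategory.functorCategory`). The pushouts and pullbacks which
the axioms ask for exist pointwise, hence exist in the functor category. For the composition axiom
one also has to find a cokernel of the composite of two admissible monomorphisms `f`, `g` as a
functor: it is the pushout of `g` along the cokernel of `f`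
(`ExactCat.IsExactCategory.comp_of_isPushout`), and dually for admissible epimorphisms.

The monomorphism category is a full subcategory of this exact category. It contains zero, and it is
closed under extensions by the five lemma for admissible monomorphisms
(`ExactCat.IsExactCategory.admissibleMono_τ₂`): in a morphism of admissible sequences whose outer
components are admissible monomorphisms, so is the middle component.

An extension-closed full subcategory of an exact category is exact
(`ExactCat.IsExactCategory.fullSubcategory`): biproducts, pushouts of admissible monomorphisms,
pullbacks of admissible epimorphisms, and the cokernels and kernels of the relevant composites
are all middle terms of admissible sequences whose outer terms lie in the subcategory.
-/

namespace ExactCat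

/-! ### Kernel-cokernel pairs -/

section KernelCokernelPairs

variable {C : Type u} [Category.{v} C] [Preadditive C]

namespace IsKernelCokernelPair

variable {T : ShortComplex C}

lemma mono_f (hT : IsKernelCokernelPair T) : Mono T.f :=
  mono_of_isLimit_fork hT.1.some

lemma epi_g (hT : IsKernelCokernelPair T) : Epi T.g :=
  epi_of_isColimit_cofork hT.2.some

lemma exists_lift (hT : IsKernelCokernelPair T) {W : C} (a : W ⟶ T.X₂) (ha : a ≫ T.g = 0) :
    ∃ b : W ⟶ T.X₁, b ≫ T.f = a :=
  ⟨_, (KernelFork.IsLimit.lift' hT.1.some a ha).2⟩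

lemma exists_desc (hT : IsKernelCokernelPair T) {W : C} (a : T.X₂ ⟶ W) (ha : T.f ≫ a = 0) :
    ∃ b : T.X₃ ⟶ W, T.g ≫ b = a :=
  ⟨_, (CokernelCofork.IsColimit.desc' hT.2.some a ha).2⟩

lemma of_exists (hf : Mono T.f) (hg : Epi T.g)
    (lift : ∀ {W : C} (a : W ⟶ T.X₂), a ≫ T.g = 0 → ∃ b : W ⟶ T.X₁, b ≫ T.f = a)
    (desc : ∀ {W : C} (a : T.X₂ ⟶ W), T.f ≫ a = 0 → ∃ b : T.X₃ ⟶ W, T.g ≫ b = a) :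
    IsKernelCokernelPair T :=
  ⟨⟨KernelFork.IsLimit.ofι' _ _ fun a ha => ⟨(lift a ha).choose, (lift a ha).choose_spec⟩⟩,
    ⟨CokernelCofork.IsColimit.ofπ' _ _ fun a ha =>
      ⟨(desc a ha).choose, (desc a ha).choose_spec⟩⟩⟩

end IsKernelCokernelPair

/-- In a preadditive category, uniqueness of the maps out of a pushout only has to be checked for
the zero map. -/
lemma isPushout_of_exists {X Y X' Y' : C} {i : X ⟶ Y} {f : X ⟶ X'} {f' : Y ⟶ Y'} {i' : X' ⟶ Y'}
    (w : i ≫ f' = f ≫ i')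
    (desc : ∀ {W : C} (a : Y ⟶ W) (b : X' ⟶ W), i ≫ a = f ≫ b →
      ∃ c : Y' ⟶ W, f' ≫ c = a ∧ i' ≫ c = b)
    (uniq : ∀ {W : C} (c : Y' ⟶ W), f' ≫ c = 0 → i' ≫ c = 0 → c = 0) :
    IsPushout i f f' i' :=
  ⟨⟨w⟩, ⟨PushoutCocone.IsColimit.mk w
    (fun s => (desc s.inl s.inr s.condition).choose)
    (fun s => (desc s.inl s.inr s.condition).choose_spec.1)
    (fun s => (desc s.inl s.inr s.condition).choose_spec.2)
    (fun s m h₁ h₂ => sub_eq_zero.1 <| uniq _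
      (by rw [Preadditive.comp_sub, h₁, (desc s.inl s.inr s.condition).choose_spec.1, sub_self])
      (by rw [Preadditive.comp_sub, h₂, (desc s.inl s.inr s.condition).choose_spec.2, sub_self]))⟩⟩

end KernelCokernelPairs

/-! ### Admissible sequences in an exact category -/

namespace IsExactCategory

variable {C : Type u} [Category.{v} C] [Preadditive C] {S : ObjectProperty (ShortComplex C)}

lemma mono_f (hS : IsExactCategory S) {X Y Z : C} {i : X ⟶ Y} {p : Y ⟶ Z} {w : i ≫ p = 0}
    (h : S (ShortComplex.mk i p w)) : Mono i :=
  (hS.isKernelCokernelPair _ h).mono_f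

lemma epi_g (hS : IsExactCategory S) {X Y Z : C} {i : X ⟶ Y} {p : Y ⟶ Z} {w : i ≫ p = 0}
    (h : S (ShortComplex.mk i p w)) : Epi p :=
  (hS.isKernelCokernelPair _ h).epi_g

lemma exists_lift (hS : IsExactCategory S) {X Y Z : C} {i : X ⟶ Y} {p : Y ⟶ Z} {w : i ≫ p = 0}
    (h : S (ShortComplex.mk i p w)) {W : C} (a : W ⟶ Y) (ha : a ≫ p = 0) :
    ∃ b : W ⟶ X, b ≫ i = a :=
  (hS.isKernelCokernelPair _ h).exists_lift a ha

lemma exists_desc (hS : IsExactCategory S) {X Y Z : C} {i : X ⟶ Y} {p : Y ⟶ Z} {w : i ≫ p = 0}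
    (h : S (ShortComplex.mk i p w)) {W : C} (a : Y ⟶ W) (ha : i ≫ a = 0) :
    ∃ b : Z ⟶ W, p ≫ b = a :=
  (hS.isKernelCokernelPair _ h).exists_desc a ha

lemma of_isos (hS : IsExactCategory S) {X Y Z X' Y' Z' : C} {i : X ⟶ Y} {p : Y ⟶ Z}
    {w : i ≫ p = 0} (h : S (ShortComplex.mk i p w)) {i' : X' ⟶ Y'} {p' : Y' ⟶ Z'}
    (w' : i' ≫ p' = 0) (e₁ : X ≅ X') (e₂ : Y ≅ Y') (e₃ : Z ≅ Z')
    (h₁ : e₁.hom ≫ i' = i ≫ e₂.hom) (h₂ : e₂.hom ≫ p' = p ≫ e₃.hom) :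
    S (ShortComplex.mk i' p' w') :=
  hS.of_iso _ _ ⟨ShortComplex.isoMk e₁ e₂ e₃ h₁ h₂⟩ h

/-- An admissible monomorphism forms an admissible sequence with each of its cokernels. -/
lemma of_admissibleMono (hS : IsExactCategory S) {X Y Z : C} {i : X ⟶ Y} {p : Y ⟶ Z}
    (hi : admissibleMono S i) (w : i ≫ p = 0) (hp : Epi p)
    (desc : ∀ {W : C} (a : Y ⟶ W), i ≫ a = 0 → ∃ b : Z ⟶ W, p ≫ b = a) :
    S (ShortComplex.mk i p w) := by
  obtain ⟨Z₀, p₀, w₀, h⟩ := hi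
  have := hS.epi_g h
  obtain ⟨u, hu⟩ := hS.exists_desc h p w
  obtain ⟨v, hv⟩ := desc p₀ w₀
  let e : Z₀ ≅ Z :=
    { hom := u
      inv := v
      hom_inv_id := by rw [← cancel_epi p₀, reassoc_of% hu, hv, Category.comp_id]
      inv_hom_id := by rw [← cancel_epi p, reassoc_of% hv, hu, Category.comp_id] }
  exact hS.of_isos h w (Iso.refl _) (Iso.refl _) e (by simp) (by simp [e, hu])

/-- An admissible epimorphism forms an admissible sequence with each of its kernels. -/
lemma of_admissibleEpi (hS : IsExactCategory S) {X Y Z : C} {i : X ⟶ Y} {p : Y ⟶ Z}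
    (hp : admissibleEpi S p) (w : i ≫ p = 0) (hi : Mono i)
    (lift : ∀ {W : C} (a : W ⟶ Y), a ≫ p = 0 → ∃ b : W ⟶ X, b ≫ i = a) :
    S (ShortComplex.mk i p w) := by
  obtain ⟨X₀, i₀, w₀, h⟩ := hp
  have := hS.mono_f h
  obtain ⟨u, hu⟩ := hS.exists_lift h i w
  obtain ⟨v, hv⟩ := lift i₀ w₀
  let e : X₀ ≅ X :=
    { hom := v
      inv := u
      hom_inv_id := by rw [← cancel_mono i₀, Category.assoc, hu, hv, Category.id_comp]
      inv_hom_id := by rw [← cancel_mono i, Category.assoc, hv, hu, Category.id_comp] }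
  exact hS.of_isos h w e (Iso.refl _) (Iso.refl _) (by simp [e, hv]) (by simp)

lemma of_isIso_of_isZero (hS : IsExactCategory S) {X Y Z : C} (f : X ⟶ Y) [IsIso f]
    (hZ : IsZero Z) : S (ShortComplex.mk f (0 : Y ⟶ Z) comp_zero) := by
  obtain ⟨Z₀, p₀, w₀, h⟩ := hS.mono_id Y
  have h' : S (ShortComplex.mk (𝟙 Y) (0 : Y ⟶ Z) comp_zero) :=
    hS.of_admissibleMono ⟨Z₀, p₀, w₀, h⟩ _ ⟨fun _ _ _ => hZ.eq_of_src _ _⟩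
      fun a ha => ⟨0, by simpa using ha.symm⟩
  exact hS.of_isos h' _ (asIso f).symm (Iso.refl _) (Iso.refl _) (by simp) (by simp)

lemma of_isZero_of_isIso (hS : IsExactCategory S) {X Y Z : C} (hX : IsZero X) (f : Y ⟶ Z)
    [IsIso f] : S (ShortComplex.mk (0 : X ⟶ Y) f zero_comp) := by
  obtain ⟨X₀, i₀, w₀, h⟩ := hS.epi_id Y
  have h' : S (ShortComplex.mk (0 : X ⟶ Y) (𝟙 Y) zero_comp) :=
    hS.of_admissibleEpi ⟨X₀, i₀, w₀, h⟩ _ ⟨fun _ _ _ => hX.eq_of_tgt _ _⟩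
      fun a ha => ⟨0, by simpa using ha.symm⟩
  exact hS.of_isos h' _ (Iso.refl _) (Iso.refl _) (asIso f) (by simp) (by simp)

/-- A pushout of the first map of an admissible sequence gives an admissible sequence with the
same third object. -/
lemma of_isPushout (hS : IsExactCategory S) {X Y Z X' Y' : C} {i : X ⟶ Y} {p : Y ⟶ Z}
    {w : i ≫ p = 0} (h : S (ShortComplex.mk i p w)) {f : X ⟶ X'} {f' : Y ⟶ Y'} {i' : X' ⟶ Y'}
    (sq : IsPushout i f f' i') {p' : Y' ⟶ Z} (hp : f' ≫ p' = p) (w' : i' ≫ p' = 0) :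
    S (ShortComplex.mk i' p' w') := by
  have := hS.epi_g h
  refine hS.of_admissibleMono ?_ w' ?_ ?_
  · obtain ⟨Y₀, f₀, i₀, sq₀, Z₀, p₀, w₀, h₀⟩ := hS.mono_pushout i f ⟨_, _, _, h⟩
    let e := sq₀.isoIsPushout _ _ sq
    have he : i₀ ≫ e.hom = i' := sq₀.inr_isoIsPushout_hom _ _ sq
    exact ⟨Z₀, e.inv ≫ p₀, by simp [← he, w₀], hS.of_isos h₀ _ (Iso.refl _) e (Iso.refl _)
      (by simp [he]) (by simp)⟩
  · rw [← hp] at this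
    exact epi_of_epi f' p'
  · intro W a ha
    obtain ⟨b, hb⟩ := hS.exists_desc h (f' ≫ a) (by rw [sq.w_assoc, ha, comp_zero])
    exact ⟨b, sq.hom_ext (by rw [reassoc_of% hp, hb]) (by rw [reassoc_of% w', zero_comp, ha])⟩

/-- A pullback of the second map of an admissible sequence gives an admissible sequence with the
same first object. -/
lemma of_isPullback (hS : IsExactCategory S) {X Y Z Y' Z' : C} {i : X ⟶ Y} {p : Y ⟶ Z}
    {w : i ≫ p = 0} (h : S (ShortComplex.mk i p w)) {f' : Y' ⟶ Y} {p' : Y' ⟶ Z'} {f : Z' ⟶ Z}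
    (sq : IsPullback f' p' p f) {i' : X ⟶ Y'} (hi : i' ≫ f' = i) (w' : i' ≫ p' = 0) :
    S (ShortComplex.mk i' p' w') := by
  have := hS.mono_f h
  refine hS.of_admissibleEpi ?_ w' ?_ ?_
  · obtain ⟨Y₀, f₀, p₀, sq₀, X₀, i₀, w₀, h₀⟩ := hS.epi_pullback p f ⟨_, _, _, h⟩
    let e := sq₀.isoIsPullback _ _ sq
    have he : e.inv ≫ p₀ = p' := sq₀.isoIsPullback_inv_snd _ _ sq
    exact ⟨X₀, i₀ ≫ e.hom, by simp [← he, w₀], hS.of_isos h₀ _ (Iso.refl _) e (Iso.refl _)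
      (by simp) (by simp [← he])⟩
  · rw [← hi] at this
    exact mono_of_mono i' f'
  · intro W a ha
    obtain ⟨b, hb⟩ := hS.exists_lift h (a ≫ f')
      (by rw [Category.assoc, sq.w, reassoc_of% ha, zero_comp])
    exact ⟨b, sq.hom_ext (by rw [Category.assoc, hi, hb])
      (by rw [Category.assoc, w', comp_zero, ha])⟩

/-- The composite of two admissible monomorphisms `f` and `g` has as cokernel the pushout of `g`
along a cokernel of `f`. -/
lemma comp_of_isPushout (hS : IsExactCategory S) {X Y Z A B W : C} {f : X ⟶ Y} {p : Y ⟶ A}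
    {wf : f ≫ p = 0} (hf : S (ShortComplex.mk f p wf)) {g : Y ⟶ Z} {q : Z ⟶ B}
    {wg : g ≫ q = 0} (hg : S (ShortComplex.mk g q wg)) {r : Z ⟶ W} {a : A ⟶ W}
    (sq : IsPushout g p r a) (w : (f ≫ g) ≫ r = 0) : S (ShortComplex.mk (f ≫ g) r w) := by
  have := hS.epi_g hf
  refine hS.of_admissibleMono (hS.mono_comp f g ⟨_, _, _, hf⟩ ⟨_, _, _, hg⟩) w
    ⟨fun x y hxy => sq.hom_ext hxy ?_⟩ fun x hx => ?_
  · rw [← cancel_epi p, ← sq.w_assoc, ← sq.w_assoc, hxy]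
  · obtain ⟨b, hb⟩ := hS.exists_desc hf (g ≫ x) (by rw [← hx, Category.assoc])
    exact ⟨sq.desc x b hb.symm, sq.inl_desc _ _ _⟩

/-- The composite of two admissible epimorphisms `f` and `g` has as kernel the pullback of `f`
along a kernel of `g`. -/
lemma comp_of_isPullback (hS : IsExactCategory S) {X Y Z J L M : C} {j : J ⟶ X} {f : X ⟶ Y}
    {wf : j ≫ f = 0} (hf : S (ShortComplex.mk j f wf)) {l : L ⟶ Y} {g : Y ⟶ Z}
    {wg : l ≫ g = 0} (hg : S (ShortComplex.mk l g wg)) {m : M ⟶ X} {b : M ⟶ L}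
    (sq : IsPullback m b f l) (w : m ≫ f ≫ g = 0) : S (ShortComplex.mk m (f ≫ g) w) := by
  have := hS.mono_f hg
  refine hS.of_admissibleEpi (hS.epi_comp f g ⟨_, _, _, hf⟩ ⟨_, _, _, hg⟩) w
    ⟨fun x y hxy => sq.hom_ext hxy ?_⟩ fun x hx => ?_
  · rw [← cancel_mono l, Category.assoc, Category.assoc, ← sq.w, reassoc_of% hxy]
  · obtain ⟨b, hb⟩ := hS.exists_lift hg (x ≫ f) (by rw [← hx, Category.assoc])
    exact ⟨sq.lift x b hb.symm, sq.lift_fst _ _ _⟩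

/-- In a morphism of admissible sequences which is the identity on the third objects, the square
on the left is a pushout. This is a form of the short five lemma, hence not a formal consequence of
the universal properties of the two sequences. -/
lemma isPushout_of_admissible (hS : IsExactCategory S) {X X' Y Y' Z : C} {i : X ⟶ Y} {p : Y ⟶ Z}
    {w : i ≫ p = 0} (h : S (ShortComplex.mk i p w)) {i' : X' ⟶ Y'} {p' : Y' ⟶ Z}
    {w' : i' ≫ p' = 0} (h' : S (ShortComplex.mk i' p' w')) {a : X ⟶ X'} {b : Y ⟶ Y'}
    (hab : i ≫ b = a ≫ i') (hb : b ≫ p' = p) : IsPushout i a b i' := by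
  have := hS.mono_f h'
  -- On `E = Y ×_Z Y'` the map `y - b u` takes values in the kernel `X'` of `p'`; calling it `r`,
  -- every map out of `Y'` is determined by its pullback along `y = u b + r i'`.
  obtain ⟨E, u, y, sq, hy⟩ := hS.epi_pullback p p' ⟨_, _, _, h⟩
  have hj : S (ShortComplex.mk (sq.lift i 0 (by simp [w])) y (by simp)) :=
    hS.of_isPullback h sq (by simp) _
  have := hS.epi_g hj
  obtain ⟨r, hr⟩ := hS.exists_lift h' (y - u ≫ b) (by simp [hb, sq.w])
  have hjr : sq.lift i 0 (by simp [w]) ≫ r = -a := by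
    rw [← cancel_mono i', Category.assoc, hr]
    simp [hab]
  have hy' : y = u ≫ b + r ≫ i' := by simp [hr]
  refine isPushout_of_exists hab (fun {W} c d hcd => ?_) fun {W} c h₁ h₂ => ?_
  · obtain ⟨k, hk⟩ := hS.exists_desc hj (u ≫ c + r ≫ d) (by
      rw [Preadditive.comp_add, sq.lift_fst_assoc, reassoc_of% hjr, hcd]; simp)
    -- The maps `(1, b) : Y ⟶ E` and `(0, i') : X' ⟶ E` recover `b` and `i'` after composing with
    -- `y`, whereas `r` restricts to `0` along the first and to the identity along the second.
    refine ⟨k, ?_, ?_⟩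
    · have hr' : sq.lift (𝟙 Y) b (by simp [hb]) ≫ r = 0 := by
        rw [← cancel_mono i', Category.assoc, hr]; simp
      have := sq.lift (𝟙 Y) b (by simp [hb]) ≫= hk
      rwa [sq.lift_snd_assoc, Preadditive.comp_add, sq.lift_fst_assoc, reassoc_of% hr', zero_comp,
        add_zero, Category.id_comp] at this
    · have hr' : sq.lift 0 i' (by simp [w']) ≫ r = 𝟙 X' := by
        rw [← cancel_mono i', Category.assoc, hr]; simp
      have := sq.lift 0 i' (by simp [w']) ≫= hk
      rwa [sq.lift_snd_assoc, Preadditive.comp_add, sq.lift_fst_assoc, reassoc_of% hr', zero_comp,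
        zero_add] at this
  · rw [← cancel_epi y, hy']
    simp [h₁, h₂]

/-- The five lemma for admissible monomorphisms. The morphism is factored through the pullback `P`
of the second sequence along `φ.τ₃`: the first factor is a pushout of `φ.τ₁`, and the second one
is a kernel of the composite of `T₂.g` with a cokernel of `φ.τ₃`. -/
lemma admissibleMono_τ₂ (hS : IsExactCategory S) {T₁ T₂ : ShortComplex C} (φ : T₁ ⟶ T₂)
    (h₁ : S T₁) (h₂ : S T₂) (ha : admissibleMono S φ.τ₁) (hc : admissibleMono S φ.τ₃) :
    admissibleMono S φ.τ₂ := by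
  obtain ⟨P, u, y, sq, -⟩ := hS.epi_pullback T₂.g φ.τ₃ ⟨_, _, _, h₂⟩
  have hP : S (ShortComplex.mk (sq.lift T₂.f 0 (by simp)) y (by simp)) :=
    hS.of_isPullback h₂ sq (by simp) _
  have hu : admissibleMono S u := by
    obtain ⟨Q, q, wq, hq⟩ := hc
    exact ⟨Q, T₂.g ≫ q, by rw [sq.w_assoc, wq, comp_zero], hS.comp_of_isPullback h₂ hq sq _⟩
  have hb : admissibleMono S (sq.lift φ.τ₂ T₁.g φ.comm₂₃) := by
    have sq' : IsPushout T₁.f φ.τ₁ (sq.lift φ.τ₂ T₁.g φ.comm₂₃) (sq.lift T₂.f 0 (by simp)) :=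
      hS.isPushout_of_admissible h₁ hP (sq.hom_ext (by simp [φ.comm₁₂]) (by simp)) (by simp)
    obtain ⟨A, q, w, h⟩ := ha
    exact ⟨A, sq'.desc 0 q (by simp [w]), by simp, hS.of_isPushout h sq'.flip (by simp) _⟩
  rw [← sq.lift_fst φ.τ₂ T₁.g φ.comm₂₃]
  exact hS.mono_comp _ _ hb hu

/-- Split sequences are admissible: `Y ⟶ 0` is an admissible epimorphism, and the projection of
`X ⊞ Y` onto `X` is a pullback of it. -/
lemma biprod_inr_fst (hS : IsExactCategory S) (X Y : C) [HasBinaryBiproduct X Y] :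
    S (ShortComplex.mk (biprod.inr : Y ⟶ X ⊞ Y) (biprod.fst : X ⊞ Y ⟶ X) (by simp)) := by
  have := hS.hasFiniteBiproducts
  have := hasZeroObject_of_hasFiniteBiproducts C
  open ZeroObject in
  exact hS.of_isPullback (hS.of_isIso_of_isZero (𝟙 Y) (isZero_zero C))
    (IsPullback.of_has_biproduct X Y).flip (by simp) _

end IsExactCategory

/-! ### Functor categories -/

section FunctorCategory

variable {J : Type*} [Category* J] {C : Type u} [Category.{v} C]

/-- Pushouts of functors can be formed pointwise, provided that the pointwise ones exist. -/
lemma exists_isPushout_app {X Y X' : J ⥤ C} (i : X ⟶ Y) (f : X ⟶ X')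
    (h : ∀ j, HasPushout (i.app j) (f.app j)) :
    ∃ (Y' : J ⥤ C) (f' : Y ⟶ Y') (i' : X' ⟶ Y'), IsPushout i f f' i' ∧
      ∀ j, IsPushout (i.app j) (f.app j) (f'.app j) (i'.app j) := by
  have (j : J) : HasColimit ((span i f).flip.obj j) :=
    have : HasColimit (span (((span i f).flip.obj j).map WalkingSpan.Hom.fst)
      (((span i f).flip.obj j).map WalkingSpan.Hom.snd)) := h j
    hasColimit_of_iso (diagramIsoSpan ((span i f).flip.obj j))
  have sq := IsPushout.of_hasPushout i f
  exact ⟨_, _, _, sq, fun j => sq.map ((evaluation J C).obj j)⟩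

/-- Pullbacks of functors can be formed pointwise, provided that the pointwise ones exist. -/
lemma exists_isPullback_app {Y Z Z' : J ⥤ C} (p : Y ⟶ Z) (f : Z' ⟶ Z)
    (h : ∀ j, HasPullback (p.app j) (f.app j)) :
    ∃ (Y' : J ⥤ C) (f' : Y' ⟶ Y) (p' : Y' ⟶ Z'), IsPullback f' p' p f ∧
      ∀ j, IsPullback (f'.app j) (p'.app j) (p.app j) (f.app j) := by
  have (j : J) : HasLimit ((cospan p f).flip.obj j) :=
    have : HasLimit (cospan (((cospan p f).flip.obj j).map WalkingCospan.Hom.inl)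
      (((cospan p f).flip.obj j).map WalkingCospan.Hom.inr)) := h j
    hasLimit_of_iso (diagramIsoCospan ((cospan p f).flip.obj j)).symm
  have sq := IsPullback.of_hasPullback p f
  exact ⟨_, _, _, sq, fun j => sq.map ((evaluation J C).obj j)⟩

variable [Preadditive C] {S : ObjectProperty (ShortComplex C)}

variable (J S) in
/-- The short complexes of functors `J ⥤ C` whose value at each object of `J` belongs to `S`. -/
def pointwiseSeq : ObjectProperty (ShortComplex (J ⥤ C)) :=
  fun T => ∀ j, S (T.map ((evaluation J C).obj j))

namespace IsExactCategory

lemma isKernelCokernelPair_of_pointwise (hS : IsExactCategory S) (T : ShortComplex (J ⥤ C))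
    (hT : pointwiseSeq J S T) : IsKernelCokernelPair T := by
  have (j : J) : Mono (T.f.app j) := hS.mono_f (hT j)
  have (j : J) : Epi (T.g.app j) := hS.epi_g (hT j)
  refine .of_exists (NatTrans.mono_of_mono_app _) (NatTrans.epi_of_epi_app _)
    (fun a ha => ?_) fun a ha => ?_
  · choose b hb using fun j => hS.exists_lift (hT j) (a.app j) (NatTrans.congr_app ha j)
    refine ⟨{ app := b, naturality := fun j j' φ => ?_ }, by ext j; exact hb j⟩
    rw [← cancel_mono (T.f.app j'), Category.assoc, Category.assoc, T.f.naturality]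
    exact (congr(_ ≫ $(hb j'))).trans
      ((a.naturality φ).trans (congr($((hb j).symm) ≫ _).trans (Category.assoc _ _ _)))
  · choose b hb using fun j => hS.exists_desc (hT j) (a.app j) (NatTrans.congr_app ha j)
    refine ⟨{ app := b, naturality := fun j j' φ => ?_ }, by ext j; exact hb j⟩
    rw [← cancel_epi (T.g.app j), ← T.g.naturality_assoc]
    exact (congr(_ ≫ $(hb j'))).trans
      ((a.naturality φ).trans (congr($((hb j).symm) ≫ _).trans (Category.assoc _ _ _)))

lemma exists_pushout_of_pointwise (hS : IsExactCategory S) {X Y X' : J ⥤ C} (i : X ⟶ Y)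
    (f : X ⟶ X') (hi : admissibleMono (pointwiseSeq J S) i) :
    ∃ (Y' : J ⥤ C) (f' : Y ⟶ Y') (i' : X' ⟶ Y'), IsPushout i f f' i' ∧
      ∀ j, IsPushout (i.app j) (f.app j) (f'.app j) (i'.app j) := by
  obtain ⟨Z, p, w, h⟩ := hi
  refine exists_isPushout_app i f fun j => ?_
  obtain ⟨_, _, _, sq, -⟩ := hS.mono_pushout (i.app j) (f.app j) ⟨_, _, _, h j⟩
  exact sq.hasPushout

lemma exists_pullback_of_pointwise (hS : IsExactCategory S) {Y Z Z' : J ⥤ C} (p : Y ⟶ Z)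
    (f : Z' ⟶ Z) (hp : admissibleEpi (pointwiseSeq J S) p) :
    ∃ (Y' : J ⥤ C) (f' : Y' ⟶ Y) (p' : Y' ⟶ Z'), IsPullback f' p' p f ∧
      ∀ j, IsPullback (f'.app j) (p'.app j) (p.app j) (f.app j) := by
  obtain ⟨X, i, w, h⟩ := hp
  refine exists_isPullback_app p f fun j => ?_
  obtain ⟨_, _, _, sq, -⟩ := hS.epi_pullback (p.app j) (f.app j) ⟨_, _, _, h j⟩
  exact sq.hasPullback

variable (J) in
/-- Functors with values in an exact category form an exact category, with the pointwise
admissible sequences. -/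
theorem functorCategory (hS : IsExactCategory S) : IsExactCategory (pointwiseSeq J S) where
  hasFiniteBiproducts := by
    have := hS.hasFiniteBiproducts
    have : HasFiniteProducts C := inferInstance
    exact HasFiniteBiproducts.of_hasFiniteProducts
  isKernelCokernelPair := hS.isKernelCokernelPair_of_pointwise
  of_iso T T' e h j :=
    hS.of_iso _ _ (e.map (((evaluation J C).obj j).mapShortComplex.mapIso)) (h j)
  mono_id X := by
    have := hS.hasFiniteBiproducts
    have := hasZeroObject_of_hasFiniteBiproducts C
    open ZeroObject in
    exact ⟨(Functor.const J).obj 0, 0, by simp, fun j =>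
      hS.of_isIso_of_isZero (𝟙 (X.obj j)) (isZero_zero C)⟩
  epi_id X := by
    have := hS.hasFiniteBiproducts
    have := hasZeroObject_of_hasFiniteBiproducts C
    open ZeroObject in
    exact ⟨(Functor.const J).obj 0, 0, by simp, fun j =>
      hS.of_isZero_of_isIso (isZero_zero C) (𝟙 (X.obj j))⟩
  mono_comp f g hf hg := by
    obtain ⟨A, p, wf, hf⟩ := hf
    obtain ⟨W, r, a, sq, sq'⟩ := hS.exists_pushout_of_pointwise g p hg
    obtain ⟨B, q, wg, hg⟩ := hg
    exact ⟨W, r, by rw [Category.assoc, sq.w, reassoc_of% wf, zero_comp],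
      fun j => hS.comp_of_isPushout (hf j) (hg j) (sq' j) _⟩
  epi_comp f g hf hg := by
    obtain ⟨L, l, wg, hg⟩ := hg
    obtain ⟨M, m, b, sq, sq'⟩ := hS.exists_pullback_of_pointwise f l hf
    obtain ⟨J, i, wf, hf⟩ := hf
    exact ⟨M, m, by rw [sq.w_assoc, wg, comp_zero],
      fun j => hS.comp_of_isPullback (hf j) (hg j) (sq' j) _⟩
  mono_pushout i f hi := by
    obtain ⟨Y', f', i', sq, sq'⟩ := hS.exists_pushout_of_pointwise i f hi
    obtain ⟨Z, p, w, h⟩ := hi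
    exact ⟨Y', f', i', sq, Z, sq.desc p 0 (by simp [w]), by simp, fun j =>
      hS.of_isPushout (h j) (sq' j) (NatTrans.congr_app (sq.inl_desc p 0 (by simp [w])) j) _⟩
  epi_pullback p f hp := by
    obtain ⟨Y', f', p', sq, sq'⟩ := hS.exists_pullback_of_pointwise p f hp
    obtain ⟨X, i, w, h⟩ := hp
    exact ⟨Y', f', p', sq, X, sq.lift i 0 (by simp [w]), by simp, fun j =>
      hS.of_isPullback (h j) (sq' j) (NatTrans.congr_app (sq.lift_fst i 0 (by simp [w])) j) _⟩

end IsExactCategory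

end FunctorCategory

/-! ### Extension-closed subcategories -/

section ExtensionClosed

variable {C : Type u} [Category.{v} C] [Preadditive C] {S : ObjectProperty (ShortComplex C)}

/-- A property of objects is extension-closed with respect to a class of sequences if it holds
for the middle term of a sequence as soon as it holds for the outer ones. -/
def IsExtensionClosed (S : ObjectProperty (ShortComplex C)) (P : ObjectProperty C) : Prop :=
  ∀ T : ShortComplex C, S T → P T.X₁ → P T.X₃ → P T.X₂

namespace IsExactCategory

variable {P : ObjectProperty C}

lemma hasFiniteBiproducts_fullSubcategory (hS : IsExactCategory S) [P.ContainsZero]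
    (hP : IsExtensionClosed S P) : HasFiniteBiproducts P.FullSubcategory := by
  have := hS.hasFiniteBiproducts
  have := HasBinaryBiproducts.of_hasBinaryProducts (C := C)
  have : HasZeroObject P.FullSubcategory := by
    obtain ⟨Z, hZ, hPZ⟩ := P.exists_prop_of_containsZero
    exact ⟨⟨Z, hPZ⟩, (IsZero.iff_id_eq_zero _).2 (P.hom_ext (hZ.eq_of_src _ _))⟩
  have : HasBinaryBiproducts P.FullSubcategory := ⟨fun X Y => by
    let B : P.FullSubcategory :=
      ⟨X.obj ⊞ Y.obj, hP _ (hS.biprod_inr_fst X.obj Y.obj) Y.property X.property⟩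
    let b : BinaryBicone X Y :=
      { pt := B
        fst := P.homMk (biprod.fst : X.obj ⊞ Y.obj ⟶ X.obj)
        snd := P.homMk (biprod.snd : X.obj ⊞ Y.obj ⟶ Y.obj)
        inl := P.homMk (biprod.inl : X.obj ⟶ X.obj ⊞ Y.obj)
        inr := P.homMk (biprod.inr : Y.obj ⟶ X.obj ⊞ Y.obj)
        inl_fst := P.hom_ext biprod.inl_fst
        inl_snd := P.hom_ext biprod.inl_snd
        inr_fst := P.hom_ext biprod.inr_fst
        inr_snd := P.hom_ext biprod.inr_snd }
    exact hasBinaryBiproduct_of_total b (P.hom_ext biprod.total)⟩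
  have : HasFiniteProducts P.FullSubcategory := hasFiniteProducts_of_has_binary_and_terminal
  exact HasFiniteBiproducts.of_hasFiniteProducts

/-- A full subcategory of an exact category which contains a zero object and is closed under
extensions is an exact category: each object that the axioms ask for is the middle term of an
admissible sequence with outer terms in the subcategory. -/
theorem fullSubcategory (hS : IsExactCategory S) [P.ContainsZero] (hP : IsExtensionClosed S P) :
    IsExactCategory (C := P.FullSubcategory) fun T => S (T.map P.ι) where
  hasFiniteBiproducts := hS.hasFiniteBiproducts_fullSubcategory hP
  isKernelCokernelPair T hT :=
    .of_exists (P.ι.mono_of_mono_map (hS.mono_f hT)) (P.ι.epi_of_epi_map (hS.epi_g hT))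
      (fun a ha => by
        obtain ⟨b, hb⟩ := hS.exists_lift hT a.hom congr(($ha).hom)
        exact ⟨P.homMk b, P.hom_ext hb⟩)
      (fun a ha => by
        obtain ⟨b, hb⟩ := hS.exists_desc hT a.hom congr(($ha).hom)
        exact ⟨P.homMk b, P.hom_ext hb⟩)
  of_iso T T' e h := hS.of_iso _ _ (e.map P.ι.mapShortComplex.mapIso) h
  mono_id X := by
    obtain ⟨Z, hZ, hPZ⟩ := P.exists_prop_of_containsZero
    exact ⟨⟨Z, hPZ⟩, 0, comp_zero, hS.of_isIso_of_isZero (𝟙 X.obj) hZ⟩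
  epi_id X := by
    obtain ⟨Z, hZ, hPZ⟩ := P.exists_prop_of_containsZero
    exact ⟨⟨Z, hPZ⟩, 0, zero_comp, hS.of_isZero_of_isIso hZ (𝟙 X.obj)⟩
  mono_comp f g hf hg := by
    obtain ⟨A, p, wf, hf⟩ := hf
    obtain ⟨B, q, wg, hg⟩ := hg
    obtain ⟨W, r, a, sq, -⟩ := hS.mono_pushout g.hom p.hom ⟨_, _, _, hg⟩
    -- The cokernel `W` of the composite is an extension of `B` by `A`.
    have hW : P W := hP _ (hS.of_isPushout (p' := sq.desc q.hom 0 (by simpa using congr(($wg).hom)))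
      hg sq (by simp) (by simp)) A.property B.property
    have w : (f ≫ g) ≫ (P.homMk r : _ ⟶ ⟨W, hW⟩) = 0 := P.hom_ext (by
      simpa [sq.w] using congr(($wf).hom ≫ a))
    exact ⟨⟨W, hW⟩, P.homMk r, w, hS.comp_of_isPushout hf hg sq congr(($w).hom)⟩
  epi_comp f g hf hg := by
    obtain ⟨J, j, wf, hf⟩ := hf
    obtain ⟨L, l, wg, hg⟩ := hg
    obtain ⟨M, m, b, sq, -⟩ := hS.epi_pullback f.hom l.hom ⟨_, _, _, hf⟩
    -- The kernel `M` of the composite is an extension of `L` by `J`.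
    have hM : P M := hP _ (hS.of_isPullback (i' := sq.lift j.hom 0 (by simpa using congr(($wf).hom)))
      hf sq (by simp) (by simp)) J.property L.property
    have w : (P.homMk m : ⟨M, hM⟩ ⟶ _) ≫ f ≫ g = 0 := P.hom_ext (by
      simpa [sq.w_assoc] using congr(b ≫ ($wg).hom))
    exact ⟨⟨M, hM⟩, P.homMk m, w, hS.comp_of_isPullback hf hg sq congr(($w).hom)⟩
  mono_pushout {X Y X'} i f hi := by
    obtain ⟨Z, p, w, h⟩ := hi
    obtain ⟨Y', f', i', sq, -⟩ := hS.mono_pushout i.hom f.hom ⟨_, _, _, h⟩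
    have h' := hS.of_isPushout (p' := sq.desc p.hom 0 (by simpa using congr(($w).hom)))
      h sq (by simp) (by simp)
    have hY : P Y' := hP _ h' X'.property Z.property
    exact ⟨⟨Y', hY⟩, P.homMk f', P.homMk i', .of_map P.ι (P.hom_ext sq.w) sq,
      Z, P.homMk (sq.desc p.hom 0 (by simpa using congr(($w).hom))), P.hom_ext (by simp), h'⟩
  epi_pullback {Y Z Z'} p f hp := by
    obtain ⟨X, i, w, h⟩ := hp
    obtain ⟨Y', f', p', sq, -⟩ := hS.epi_pullback p.hom f.hom ⟨_, _, _, h⟩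
    have h' := hS.of_isPullback (i' := sq.lift i.hom 0 (by simpa using congr(($w).hom)))
      h sq (by simp) (by simp)
    have hY : P Y' := hP _ h' X.property Z'.property
    exact ⟨⟨Y', hY⟩, P.homMk f', P.homMk p', .of_map P.ι (P.hom_ext sq.w) sq,
      X, P.homMk (sq.lift i.hom 0 (by simpa using congr(($w).hom))), P.hom_ext (by simp), h'⟩

end IsExactCategory

end ExtensionClosed

/-! ### Chains of admissible monomorphisms -/

section MonoChain

variable {C : Type u} [Category.{v} C] [Preadditive C] {S : ObjectProperty (ShortComplex C)}

lemma containsZero_isMonoChain (hS : IsExactCategory S) (k : ℕ) :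
    (isMonoChain S k).ContainsZero := by
  have := hS.hasFiniteBiproducts
  have := hasZeroObject_of_hasFiniteBiproducts C
  open ZeroObject in
  exact ⟨(Functor.const _).obj 0, Functor.isZero _ fun _ => isZero_zero C,
    fun _ => hS.mono_id (0 : C)⟩

/-- This is the five lemma for admissible monomorphisms, applied to each map of the chain. -/
lemma isExtensionClosed_isMonoChain (hS : IsExactCategory S) (k : ℕ) :
    IsExtensionClosed (morSeq S k) (isMonoChain S k) := fun T hT h₁ h₃ i =>
  hS.admissibleMono_τ₂ (T.mapNatTrans
    ((evaluation (Fin (k + 1)) C).map (homOfLE (Fin.castSucc_le_succ i))))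
    (hT _) (hT _) (h₁ i) (h₃ i)

end MonoChain

end ExactCat

theorem mainTheorem4 {C : Type u} [Category.{v} C] [Preadditive C]
    (S : ObjectProperty (ShortComplex C)) (hS : ExactCat.IsExactCategory S) (k : ℕ) :
    ExactCat.IsExactCategory (ExactCat.mmorSeq S k) := by
  have := ExactCat.containsZero_isMonoChain hS k
  exact (hS.functorCategory (Fin (k + 1))).fullSubcategory
    (ExactCat.isExtensionClosed_isMonoChain hS k)
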